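/- Let $k\ge 2$ be an integer. Write $\hat f(\xi)=\int_{\mathbb R^k}e^{-ix\cdot\xi}f(x)\,dx$ for the Fourier transform on $\mathbb R^k$, extended to $L^2(\mathbb R^k)$. Let $\varphi:\mathbb R^k\to\mathbb R$ be a smooth radial function with $\varphi(\xi)=1$ for $|\xi|\le 1$ and $\varphi(\xi)=0$ for $|\xi|\ge 2$. For $M\in 2^{\mathbb Z}$ and $t\in\mathbb R$ define the operators $P_M$ and $e^{it\Lambda^k}$ (where $\Lambda=\sqrt{-\Delta}$) on $L^2(\mathbb R^k)$ by $$\widehat{P_Mf}(\xi)=\big(\varphi(M^{-1}\xi)-\varphi(2M^{-1}\xi)\big)\hat f(\xi),\qquad \widehat{e^{it\Lambda^k}f}(\xi)=e^{it|\xi|^k}\hat f(\xi).$$ Then there is a constant $C>0$, depending only on $k$ and $\varphi$, such that for all $M_1,M_2\in 2^{\mathbb Z}$ with $M_1\le M_2$ and all complex-valued $u_0,v_0\in L^2(\mathbb R^k)$, the function $(t,x)\mapsto (e^{it\Lambda^k}P_{M_1}u_0)(x)\,(e^{it\Lambda^k}P_{M_2}v_0)(x)$ belongs to $L^2(\mathbb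 R\times\mathbb R^k)$ and $$\big\|[e^{it\Lambda^k}P_{M_1}u_0]\,[e^{it\Lambda^k}P_{M_2}v_0]\big\|_{L^2_tL^2_x(\mathbb R\times\mathbb R^k)}\le C\left(\frac{M_1}{M_2}\right)^{(k-1)/2}\|u_0\|_{L^2(\mathbb R^k)}\|v_0\|_{L^2(\mathbb R^k)}.$$ -/

import Mathlib

open MeasureTheory
open scoped ContDiff ENNReal FourierTransform BoundedContinuousFunction

noncomputable section

/-- The Euclidean space `ℝ^k`. -/
abbrev Euc (k : ℕ) : Type := EuclideanSpace ℝ (Fin k)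

/-- The Hilbert space `L²(ℝ^k; ℂ)`, with Lebesgue measure. -/
abbrev LTwo (k : ℕ) : Type := Lp ℂ 2 (volume : Measure (Euc k))

/-- `f` times a bounded continuous function `m` evaluated at dilated frequencies is again in `L²`. -/
theorem memLp_symbol_mul {k : ℕ} (m : Euc k →ᵇ ℂ) (f : LTwo k) :
    MemLp (fun ξ : Euc k => m ((2 * Real.pi) • ξ) * f ξ) 2 volume := by
  refine MemLp.of_le_mul (c := ‖m‖) (Lp.memLp f) ?_ ?_
  · have hc : Continuous fun ξ : Euc k => m ((2 * Real.pi) • ξ) := by fun_prop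
    exact hc.aestronglyMeasurable.mul (Lp.aestronglyMeasurable f)
  · refine Filter.Eventually.of_forall fun ξ => ?_
    rw [norm_mul]
    exact mul_le_mul_of_nonneg_right (m.norm_coe_le_norm _) (norm_nonneg _)

/-- The Fourier multiplier on `L²(ℝ^k)` with bounded continuous symbol `m`, with respect to the
Fourier transform `f̂(ξ) = ∫ e^{-i x·ξ} f(x) dx`: it multiplies `f̂(ξ)` by `m ξ`.
Mathlib's transform is `𝓕 f (ξ) = ∫ e^{-2π i x·ξ} f(x) dx = f̂(2πξ)`, extended unitarily to `L²`,
so that `𝓕 f (ξ)` is multiplied by `m (2πξ)`. -/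
def fourierMult {k : ℕ} (m : Euc k →ᵇ ℂ) (f : LTwo k) : LTwo k :=
  𝓕⁻ ((memLp_symbol_mul m (𝓕 f)).toLp (fun ξ : Euc k => m ((2 * Real.pi) • ξ) * (𝓕 f : LTwo k) ξ))

/-- The symbol `e^{it|ξ|^k}`. -/
def propagatorSymbol (k : ℕ) (t : ℝ) : Euc k →ᵇ ℂ :=
  BoundedContinuousFunction.ofNormedAddCommGroup
    (fun ξ : Euc k => Complex.exp (((t * ‖ξ‖ ^ k : ℝ) : ℂ) * Complex.I))
    (by fun_prop) 1 (fun ξ => (Complex.norm_exp_ofReal_mul_I _).le)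

/-- The linear propagator `e^{itΛ^k}` on `L²(ℝ^k)`, where `Λ = √(-Δ)` is the Fourier multiplier
by `|ξ|`. -/
def propagator (k : ℕ) (t : ℝ) (f : LTwo k) : LTwo k := fourierMult (propagatorSymbol k t) f

/-- A smooth, real-valued, radial function equal to `1` on `|ξ| ≤ 1` and to `0` on `|ξ| ≥ 2`. -/
structure LPCutoff (k : ℕ) where
  /-- the underlying function -/
  toFun : Euc k → ℝ
  smooth : ContDiff ℝ ∞ toFun
  radial : ∀ ξ η : Euc k, ‖ξ‖ = ‖η‖ → toFun ξ = toFun η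
  eq_one : ∀ ξ : Euc k, ‖ξ‖ ≤ 1 → toFun ξ = 1
  eq_zero : ∀ ξ : Euc k, 2 ≤ ‖ξ‖ → toFun ξ = 0

/-- A cutoff function is bounded. -/
theorem LPCutoff.exists_bound {k : ℕ} (φ : LPCutoff k) : ∃ B : ℝ, ∀ ξ : Euc k, ‖φ.toFun ξ‖ ≤ B := by
  have hsupp : HasCompactSupport φ.toFun := by
    refine HasCompactSupport.intro (isCompact_closedBall (0 : Euc k) 2) fun ξ hξ => ?_
    apply φ.eq_zero
    rw [Metric.mem_closedBall, dist_zero_right, not_le] at hξ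
    exact hξ.le
  exact hsupp.exists_bound_of_continuous φ.smooth.continuous

/-- The symbol `φ(M⁻¹ξ) - φ(2M⁻¹ξ)` of the Littlewood-Paley operator `P_M`. -/
def lpSymbol {k : ℕ} (φ : LPCutoff k) (M : ℝ) : Euc k →ᵇ ℂ :=
  BoundedContinuousFunction.ofNormedAddCommGroup
    (fun ξ : Euc k => ((φ.toFun (M⁻¹ • ξ) - φ.toFun ((2 * M⁻¹) • ξ) : ℝ) : ℂ))
    (by
      have := φ.smooth.continuous
      fun_prop)
    (φ.exists_bound.choose + φ.exists_bound.choose)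
    (fun ξ => by
      rw [Complex.norm_real]
      exact (norm_sub_le _ _).trans
        (add_le_add (φ.exists_bound.choose_spec _) (φ.exists_bound.choose_spec _)))

/-- The Littlewood-Paley operator `P_M` on `L²(ℝ^k)`. -/
def lpProj {k : ℕ} (φ : LPCutoff k) (M : ℝ) (f : LTwo k) : LTwo k := fourierMult (lpSymbol φ M) f

/-- `M` is a dyadic number, `M ∈ 2^ℤ`. -/
def IsDyadic (M : ℝ) : Prop := ∃ j : ℤ, M = (2 : ℝ) ^ j

/-- The function `W` on `ℝ × ℝ^k` represents the product of the two curves `U, V` in `L²(ℝ^k)`: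
`W(t, ·) = U(t) V(t)` almost everywhere on `ℝ^k`, for every time `t`. A jointly measurable `W`
with this property is unique up to a null set of `ℝ × ℝ^k`. -/
def IsSpaceTimeProduct {k : ℕ} (W : ℝ × Euc k → ℂ) (U V : ℝ → LTwo k) : Prop :=
  ∀ t : ℝ, (fun x : Euc k => W (t, x)) =ᵐ[volume] fun x : Euc k => U t x * V t x

end

/-!
Both waves have compactly supported Fourier transforms, so their product is the absolutely convergent
oscillatory integral `W(t, x) = ∬ e^{2πi (t τ + x·ξ)} f η * g ζ dη dζ`, where `ξ = η + ζ` and `τ` is a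
multiple of `|η|^k + |ζ|^k`. The estimate rests on two facts.

* `lintegral_oscIntegral_sq_le`: if a map `H` pushes a measure `μ` forward to at most `A` times
  Lebesgue measure, then the oscillatory integral with phase `⟪H p, v⟫` is bounded by `√A` from
  `L²(μ)` to `L²`. With the weight `e^{-δ‖v‖²}` the square of the `L²` norm is a quadratic form whose
  kernel is an approximate identity evaluated at `H p - H p'`; Schur's test bounds it by `A`
  uniformly in `δ`, and `δ → 0`.
* `map_sumMap_le`: on the frequency supports, `(η, ζ) ↦ (τ, ξ)` pushes Lebesgue measure forward to at
  most `C (M₁ / M₂)^(k-1)` times Lebesgue measure. By Fubini it is enough to fix `ξ` and to look at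
  the phase as a function of `η` (`setLIntegral_fibre_le`). In polar coordinates `η = ξ/2 + r θ`,
  `ζ = ξ/2 - r θ`, the phase increases in `r` with derivative at least
  `k r (|η|^(k-2) + |ζ|^(k-2))`, which controls the Jacobian `r^(k-1)` because `r` is at most
  comparable to `|ζ|`. The gain comes from the directions `θ`: the ray from `ξ/2` must meet a ball of
  radius comparable to `M₁` about the origin, and if `M₁` is much smaller than `M₂` this ball is at
  a distance comparable to `M₂` from `ξ/2` (`toSphere_directions_le`). If `M₁` and `M₂` are
  comparable there is nothing to gain.

Since the propagator is defined through the `L²` Fourier transform, `fourierInv_toLp_ae_eq` identifies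
it with the oscillatory integral on `L¹ ∩ L²`.
-/

/-! ### Oscillatory integrals and the `L²` extension estimate -/

section Extension

variable {V : Type*} [NormedAddCommGroup V] [InnerProductSpace ℝ V]

/-- The Fourier transform of the Gaussian `exp (-δ ‖v‖²)`, as a real function. -/
noncomputable def gaussianKernel (δ : ℝ) (w : V) : ℝ :=
  (Real.pi / δ) ^ ((Module.finrank ℝ V : ℝ) / 2) * Real.exp (-(Real.pi ^ 2 / δ) * ‖w‖ ^ 2)

theorem gaussianKernel_nonneg {δ : ℝ} (hδ : 0 < δ) (w : V) : 0 ≤ gaussianKernel δ w := by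
  unfold gaussianKernel; positivity

theorem continuous_gaussianKernel (δ : ℝ) : Continuous (gaussianKernel δ : V → ℝ) := by
  unfold gaussianKernel; fun_prop

variable {X : Type*} [MeasurableSpace X]

/-- The oscillatory integral `∫ exp (2πi ⟪H x, v⟫) F x dμ(x)`: the adjoint of the restriction of the
Fourier transform to the parametrised set `H`. -/
noncomputable def oscIntegral (μ : Measure X) (H : X → V) (F : X → ℂ) (v : V) : ℂ :=
  ∫ x, Complex.exp (((2 * Real.pi * inner ℝ (H x) v : ℝ) : ℂ) * Complex.I) * F x ∂μ

theorem norm_oscIntegral_le {μ : Measure X} {H : X → V} {F : X → ℂ} (v : V) :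
    ‖oscIntegral μ H F v‖ ≤ ∫ x, ‖F x‖ ∂μ := by
  refine (norm_integral_le_integral_norm _).trans (le_of_eq ?_)
  congr 1; ext x
  rw [norm_mul, Complex.norm_exp_ofReal_mul_I, one_mul]

theorem oscIntegral_mul_conj {μ : Measure X} [SFinite μ] {H : X → V} {F : X → ℂ} (v : V) :
    oscIntegral μ H F v * (starRingEnd ℂ) (oscIntegral μ H F v) =
      ∫ z : X × X, Complex.exp (((2 * Real.pi * inner ℝ (H z.1 - H z.2) v : ℝ) : ℂ) * Complex.I) *
        (F z.1 * (starRingEnd ℂ) (F z.2)) ∂(μ.prod μ) := by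
  unfold oscIntegral
  rw [← integral_conj, ← integral_prod_mul]
  congr 1; ext z
  rw [map_mul, ← Complex.exp_conj, map_mul, Complex.conj_ofReal, Complex.conj_I, inner_sub_left,
    mul_mul_mul_comm, ← Complex.exp_add]
  congr 2
  push_cast; ring

variable [FiniteDimensional ℝ V] [MeasurableSpace V] [BorelSpace V]

theorem integral_gaussian_mul_exp {δ : ℝ} (hδ : 0 < δ) (w : V) :
    ∫ v : V, (Real.exp (-δ * ‖v‖ ^ 2) : ℂ) *
      Complex.exp (((2 * Real.pi * inner ℝ w v : ℝ) : ℂ) * Complex.I) =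
      (gaussianKernel δ w : ℂ) := by
  have h := GaussianFourier.integral_cexp_neg_mul_sq_norm_add (V := V) (b := (δ : ℂ))
    (by simpa using hδ) (2 * Real.pi * Complex.I) w
  have hne : (δ : ℂ) ≠ 0 := by exact_mod_cast hδ.ne'
  calc _ = ∫ v : V, Complex.exp (-(δ : ℂ) * ‖v‖ ^ 2 + 2 * Real.pi * Complex.I *
        (inner ℝ w v : ℝ)) := by
        congr 1; ext v
        push_cast
        rw [← Complex.exp_add]
        congr 1; ring
    _ = _ := by
        rw [h, gaussianKernel]
        push_cast
        congr 1
        · rw [Complex.ofReal_cpow (by positivity)]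
          push_cast; rfl
        · congr 1
          rw [mul_pow, mul_pow, Complex.I_sq]
          field_simp
          ring

theorem integrable_gaussian {δ : ℝ} (hδ : 0 < δ) :
    Integrable (fun v : V => Real.exp (-δ * ‖v‖ ^ 2)) := by
  have h := GaussianFourier.integrable_cexp_neg_mul_sq_norm_add (V := V) (b := (δ : ℂ))
    (by simpa using hδ) 0 0
  have h2 := h.re
  refine h2.congr (Filter.Eventually.of_forall fun v => ?_)
  have : (-(δ : ℂ) * ‖v‖ ^ 2 + 0 * ((inner ℝ (0 : V) v : ℝ) : ℂ)) = ((-δ * ‖v‖ ^ 2 : ℝ) : ℂ) := by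
    push_cast; ring
  simp only [this, ← Complex.ofReal_exp]
  exact Complex.ofReal_re _

theorem lintegral_gaussianKernel {δ : ℝ} (hδ : 0 < δ) (w₀ : V) :
    ∫⁻ w : V, ENNReal.ofReal (gaussianKernel δ (w₀ - w)) = 1 := by
  have hb : 0 < Real.pi ^ 2 / δ := by positivity
  rw [lintegral_sub_left_eq_self (fun w => ENNReal.ofReal (gaussianKernel δ w)) w₀]
  simp only [gaussianKernel]
  rw [← ofReal_integral_eq_lintegral_ofReal ((integrable_gaussian hb).const_mul _)
    (Filter.Eventually.of_forall fun w => gaussianKernel_nonneg hδ w)]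
  rw [integral_const_mul, GaussianFourier.integral_rexp_neg_mul_sq_norm hb,
    ← Real.mul_rpow (by positivity) (by positivity)]
  have : Real.pi / δ * (Real.pi / (Real.pi ^ 2 / δ)) = 1 := by
    field_simp
  rw [this, Real.one_rpow, ENNReal.ofReal_one]

theorem continuous_oscIntegral {μ : Measure X} {H : X → V} {F : X → ℂ} (hH : Measurable H)
    (hF : Integrable F μ) : Continuous (oscIntegral μ H F) := by
  refine continuous_of_dominated (bound := fun x => ‖F x‖) (fun v => ?_) (fun v => ?_) hF.norm ?_
  · refine AEStronglyMeasurable.mul ?_ hF.1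
    exact Measurable.aestronglyMeasurable (by fun_prop)
  · refine Filter.Eventually.of_forall fun x => ?_
    rw [norm_mul, Complex.norm_exp_ofReal_mul_I, one_mul]
  · refine Filter.Eventually.of_forall fun x => ?_
    fun_prop

/-- With a Gaussian weight, the square of the oscillatory integral is a quadratic form in `F` whose
kernel is an approximate identity composed with `H`. -/
theorem integral_gaussian_oscIntegral {μ : Measure X} [SFinite μ] {H : X → V} {F : X → ℂ}
    (hH : Measurable H) (hF : Integrable F μ) {δ : ℝ} (hδ : 0 < δ) :
    ∫ v : V, ((Real.exp (-δ * ‖v‖ ^ 2) * ‖oscIntegral μ H F v‖ ^ 2 : ℝ) : ℂ) =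
      ∫ z : X × X, (gaussianKernel δ (H z.1 - H z.2) : ℂ) *
        (F z.1 * (starRingEnd ℂ) (F z.2)) ∂(μ.prod μ) := by
  have hFF : Integrable (fun z : X × X => F z.1 * (starRingEnd ℂ) (F z.2)) (μ.prod μ) :=
    hF.mul_prod (Complex.conjLIE.integrable_comp_iff.2 hF)
  have hint : Integrable (fun p : V × (X × X) =>
      Complex.exp (((2 * Real.pi * inner ℝ (H p.2.1 - H p.2.2) p.1 : ℝ) : ℂ) * Complex.I) *
      ((Real.exp (-δ * ‖p.1‖ ^ 2) : ℂ) * (F p.2.1 * (starRingEnd ℂ) (F p.2.2))))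
      ((volume : Measure V).prod (μ.prod μ)) := by
    refine Integrable.bdd_mul (c := 1) ((integrable_gaussian hδ).ofReal.mul_prod hFF) ?_ ?_
    · exact Measurable.aestronglyMeasurable (by fun_prop)
    · exact Filter.Eventually.of_forall fun p => (Complex.norm_exp_ofReal_mul_I _).le
  calc _ = ∫ v : V, ∫ z : X × X,
        Complex.exp (((2 * Real.pi * inner ℝ (H z.1 - H z.2) v : ℝ) : ℂ) * Complex.I) *
      ((Real.exp (-δ * ‖v‖ ^ 2) : ℂ) * (F z.1 * (starRingEnd ℂ) (F z.2))) ∂(μ.prod μ) := by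
        congr 1; ext v
        rw [Complex.ofReal_mul, Complex.ofReal_pow, ← Complex.mul_conj', oscIntegral_mul_conj,
          ← integral_const_mul]
        congr 1; ext z; ring
    _ = _ := by
        rw [integral_integral_swap hint]
        congr 1; ext z
        rw [← integral_gaussian_mul_exp hδ, ← integral_mul_const]
        congr 1; ext v; ring

/-- Schur's test for the quadratic form in `integral_gaussian_oscIntegral`. -/
theorem lintegral_gaussian_oscIntegral_le {μ : Measure X} [SFinite μ] {H : X → V} {F : X → ℂ}
    (hH : Measurable H) (hF : Integrable F μ) {A : ℝ≥0∞} (hA : μ.map H ≤ A • volume)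
    {δ : ℝ} (hδ : 0 < δ) :
    ∫⁻ v : V, ENNReal.ofReal (Real.exp (-δ * ‖v‖ ^ 2)) * ‖oscIntegral μ H F v‖ₑ ^ 2 ≤
      A * ∫⁻ x, ‖F x‖ₑ ^ 2 ∂μ := by
  have hcont := continuous_oscIntegral hH hF
  have hint : Integrable (fun v : V => Real.exp (-δ * ‖v‖ ^ 2) * ‖oscIntegral μ H F v‖ ^ 2) := by
    refine Integrable.mul_bdd (c := (∫ x, ‖F x‖ ∂μ) ^ 2) (integrable_gaussian hδ)
      (by fun_prop) (Filter.Eventually.of_forall fun v => ?_)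
    rw [norm_pow, norm_norm]
    exact pow_le_pow_left₀ (norm_nonneg _) (norm_oscIntegral_le v) 2
  have h1 : ∫⁻ v : V, ENNReal.ofReal (Real.exp (-δ * ‖v‖ ^ 2)) * ‖oscIntegral μ H F v‖ₑ ^ 2 =
      ‖∫ v : V, ((Real.exp (-δ * ‖v‖ ^ 2) * ‖oscIntegral μ H F v‖ ^ 2 : ℝ) : ℂ)‖ₑ := by
    rw [integral_complex_ofReal, ← ofReal_norm, Complex.norm_real, Real.norm_of_nonneg
      (integral_nonneg fun v => by positivity), ofReal_integral_eq_lintegral_ofReal hint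
      (Filter.Eventually.of_forall fun v => by positivity)]
    congr 1; ext v
    rw [ENNReal.ofReal_mul (Real.exp_nonneg _), ENNReal.ofReal_pow (norm_nonneg _),
      ofReal_norm]
  set G : X × X → ℝ≥0∞ := fun z => ENNReal.ofReal (gaussianKernel δ (H z.1 - H z.2)) with hG
  have hgc := continuous_gaussianKernel (V := V) δ
  have hgm : Measurable (fun w : V => ENNReal.ofReal (gaussianKernel δ w)) :=
    hgc.measurable.ennreal_ofReal
  have hGm : Measurable G := hgm.comp (by fun_prop)
  have hGsymm : ∀ x y, G (x, y) = G (y, x) := fun x y => by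
    simp only [hG, gaussianKernel]
    rw [norm_sub_rev]
  have hrow : ∀ x, ∫⁻ y, G (x, y) ∂μ ≤ A := fun x => by
    have hm : Measurable fun w : V => ENNReal.ofReal (gaussianKernel δ (H x - w)) :=
      hgm.comp (by fun_prop)
    calc ∫⁻ y, G (x, y) ∂μ
        = ∫⁻ w, ENNReal.ofReal (gaussianKernel δ (H x - w)) ∂(μ.map H) :=
          (lintegral_map hm hH).symm
      _ ≤ ∫⁻ w, ENNReal.ofReal (gaussianKernel δ (H x - w)) ∂(A • volume) :=
          lintegral_mono' hA le_rfl
      _ = A := by rw [lintegral_smul_measure, lintegral_gaussianKernel hδ, smul_eq_mul, mul_one]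
  have hFm : AEMeasurable (fun x => ‖F x‖ₑ ^ 2) μ := hF.1.enorm.pow_const 2
  have hm₁ : AEMeasurable (fun z => G z * ‖F z.1‖ₑ ^ 2) (μ.prod μ) :=
    hGm.aemeasurable.mul hFm.comp_fst
  have hm₂ : AEMeasurable (fun z => G z * ‖F z.2‖ₑ ^ 2) (μ.prod μ) :=
    hGm.aemeasurable.mul hFm.comp_snd
  have hfst : ∫⁻ z, G z * ‖F z.1‖ₑ ^ 2 ∂(μ.prod μ) ≤ A * ∫⁻ x, ‖F x‖ₑ ^ 2 ∂μ := by
    rw [lintegral_prod _ hm₁, ← lintegral_const_mul'' _ hFm]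
    refine lintegral_mono fun x => ?_
    dsimp only
    rw [lintegral_mul_const _ (by fun_prop)]
    gcongr
    exact hrow x
  have hsnd : ∫⁻ z, G z * ‖F z.2‖ₑ ^ 2 ∂(μ.prod μ) ≤ A * ∫⁻ x, ‖F x‖ₑ ^ 2 ∂μ := by
    rw [lintegral_prod_symm _ hm₂, ← lintegral_const_mul'' _ hFm]
    refine lintegral_mono fun y => ?_
    dsimp only
    rw [lintegral_mul_const _ (by fun_prop)]
    gcongr
    simp only [fun x => hGsymm x y]
    exact hrow y
  rw [h1, integral_gaussian_oscIntegral hH hF hδ]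
  -- the inequality of arithmetic and geometric means replaces Cauchy-Schwarz in Schur's test
  have h2 : ∀ a b : ℂ, ‖a‖ₑ * ‖b‖ₑ ≤ 2⁻¹ * (‖a‖ₑ ^ 2 + ‖b‖ₑ ^ 2) := fun a b => by
    rw [← ofReal_norm, ← ofReal_norm, ← ENNReal.ofReal_mul (norm_nonneg _),
      ← ENNReal.ofReal_pow (norm_nonneg _), ← ENNReal.ofReal_pow (norm_nonneg _),
      ← ENNReal.ofReal_add (by positivity) (by positivity),
      show (2⁻¹ : ℝ≥0∞) = ENNReal.ofReal 2⁻¹ by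
        rw [ENNReal.ofReal_inv_of_pos two_pos, ENNReal.ofReal_ofNat],
      ← ENNReal.ofReal_mul (by norm_num)]
    exact ENNReal.ofReal_le_ofReal (by nlinarith [sq_nonneg (‖a‖ - ‖b‖)])
  calc _ ≤ ∫⁻ z : X × X, ‖(gaussianKernel δ (H z.1 - H z.2) : ℂ) *
        (F z.1 * (starRingEnd ℂ) (F z.2))‖ₑ ∂(μ.prod μ) := enorm_integral_le_lintegral_enorm _
    _ ≤ ∫⁻ z, 2⁻¹ * (G z * ‖F z.1‖ₑ ^ 2 + G z * ‖F z.2‖ₑ ^ 2) ∂(μ.prod μ) := by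
        refine lintegral_mono fun z => ?_
        have e1 : ‖(gaussianKernel δ (H z.1 - H z.2) : ℂ)‖ₑ = G z := by
          rw [← ofReal_norm, Complex.norm_real,
            Real.norm_of_nonneg (gaussianKernel_nonneg hδ _)]
        have e2 : ‖(starRingEnd ℂ) (F z.2)‖ₑ = ‖F z.2‖ₑ := by
          rw [← ofReal_norm, RCLike.norm_conj, ofReal_norm]
        rw [enorm_mul, enorm_mul, e1, e2, ← mul_add]
        exact (mul_le_mul_right (h2 _ _) _).trans_eq (mul_left_comm _ _ _)
    _ = 2⁻¹ * (∫⁻ z, G z * ‖F z.1‖ₑ ^ 2 ∂(μ.prod μ) + ∫⁻ z, G z * ‖F z.2‖ₑ ^ 2 ∂(μ.prod μ)) := by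
        rw [lintegral_const_mul' _ _ (by simp), lintegral_add_left' hm₁]
    _ ≤ 2⁻¹ * (A * ∫⁻ x, ‖F x‖ₑ ^ 2 ∂μ + A * ∫⁻ x, ‖F x‖ₑ ^ 2 ∂μ) := by gcongr
    _ = _ := by
        rw [← two_mul, ← mul_assoc, ENNReal.inv_mul_cancel (by simp) (by simp), one_mul]

/-- The `L²` extension estimate: if the push-forward of `μ` under `H` is at most `A` times Lebesgue
measure, then `F ↦ oscIntegral μ H F` has norm at most `√A` from `L²(μ)` to `L²(V)`. -/
theorem lintegral_oscIntegral_sq_le {μ : Measure X} [SFinite μ] {H : X → V} {F : X → ℂ}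
    (hH : Measurable H) (hF : Integrable F μ) {A : ℝ≥0∞} (hA : μ.map H ≤ A • volume) :
    ∫⁻ v : V, ‖oscIntegral μ H F v‖ₑ ^ 2 ≤ A * ∫⁻ x, ‖F x‖ₑ ^ 2 ∂μ := by
  have hcont := continuous_oscIntegral hH hF
  let f : ℕ → V → ℝ≥0∞ := fun n v =>
    ENNReal.ofReal (Real.exp (-(1 / ((n : ℝ) + 1)) * ‖v‖ ^ 2)) * ‖oscIntegral μ H F v‖ₑ ^ 2
  have hlim : ∀ v, Filter.Tendsto (fun n => f n v) Filter.atTop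
      (nhds (‖oscIntegral μ H F v‖ₑ ^ 2)) := fun v => by
    have h0 : Filter.Tendsto (fun n : ℕ => Real.exp (-(1 / ((n : ℝ) + 1)) * ‖v‖ ^ 2))
        Filter.atTop (nhds 1) := by
      have := ((tendsto_one_div_add_atTop_nhds_zero_nat (𝕜 := ℝ)).neg.mul_const (‖v‖ ^ 2)).rexp
      simpa using this
    have h1 := ENNReal.Tendsto.mul_const (b := ‖oscIntegral μ H F v‖ₑ ^ 2)
      (ENNReal.tendsto_ofReal h0) (Or.inr (by finiteness))
    simpa [f] using h1
  calc _ = ∫⁻ v, Filter.liminf (fun n => f n v) Filter.atTop :=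
        lintegral_congr fun v => (hlim v).liminf_eq.symm
    _ ≤ Filter.liminf (fun n => ∫⁻ v, f n v) Filter.atTop :=
        lintegral_liminf_le fun n => by
          have := hcont.measurable
          fun_prop
    _ ≤ _ := by
        refine Filter.liminf_le_of_le (by isBoundedDefault) fun b hb => ?_
        obtain ⟨n, hn⟩ := hb.exists
        exact hn.trans (lintegral_gaussian_oscIntegral_le hH hF hA (by positivity))

end Extension

/-! ### The inverse Fourier transform on `L¹ ∩ L²` -/

section L2Fourier
variable {E : Type*} [NormedAddCommGroup E] [InnerProductSpace ℝ E] [FiniteDimensional ℝ E]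
  [MeasurableSpace E] [BorelSpace E]
open scoped SchwartzMap

theorem fourierInv_eq_oscIntegral (f : E → ℂ) (x : E) : 𝓕⁻ f x = oscIntegral volume id f x := by
  rw [Real.fourierInv_eq', oscIntegral]
  rfl

theorem integral_oscIntegral_mul {f : E → ℂ} {g : E → ℂ} (hf : Integrable f) (hg : Integrable g) :
    ∫ x, oscIntegral volume id g x * f x = ∫ x, g x * oscIntegral volume id f x := by
  have h := VectorFourier.integral_fourierIntegral_smul_eq_flip (L := -innerₗ E)
    (e := Real.fourierChar) (μ := volume) (ν := volume) Real.continuous_fourierChar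
    (continuous_inner (𝕜 := ℝ) (E := E)).neg hg hf
  simp only [← fourierInv_eq_oscIntegral, Real.fourierInv_eq]
  simpa [VectorFourier.fourierIntegral, real_inner_comm] using h

/-- On `L¹ ∩ L²` the `L²` inverse Fourier transform is given by the integral. -/
theorem fourierInv_toLp_ae_eq {f : E → ℂ} (hf : Integrable f) (hf2 : MemLp f 2 volume) :
    (𝓕⁻ (hf2.toLp f) : Lp ℂ 2 (volume : Measure E)) =ᵐ[volume] oscIntegral volume id f := by
  refine ae_eq_of_integral_contDiff_smul_eq ?_ ?_ fun g hg hgs => ?_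
  · exact (Lp.memLp _).locallyIntegrable (by norm_num)
  · exact (continuous_oscIntegral measurable_id hf).locallyIntegrable
  · have hs : HasCompactSupport fun x => (g x : ℂ) := hgs.comp_left Complex.ofReal_zero
    let ψ : 𝓢(E, ℂ) := hs.toSchwartzMap (Complex.ofRealCLM.contDiff.comp hg)
    have h := congrArg (fun T => T ψ) (Lp.fourierInv_toTemperedDistribution_eq (hf2.toLp f))
    simp only [TemperedDistribution.fourierInv_apply, Lp.toTemperedDistribution_apply,
      smul_eq_mul] at h
    have hψ : ∀ x, ψ x = (g x : ℂ) := fun x => rfl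
    simp only [hψ] at h
    calc _ = ∫ x, (g x : ℂ) * (𝓕⁻ (hf2.toLp f) : Lp ℂ 2 (volume : Measure E)) x := by
          simp only [Complex.real_smul]
      _ = ∫ x, 𝓕⁻ ψ x * hf2.toLp f x := h.symm
      _ = ∫ x, oscIntegral volume id ψ x * f x := by
          refine integral_congr_ae ?_
          filter_upwards [hf2.coeFn_toLp] with x hx
          rw [hx, SchwartzMap.fourierInv_coe, fourierInv_eq_oscIntegral]
      _ = _ := by
          rw [integral_oscIntegral_mul hf ψ.integrable]
          simp only [Complex.real_smul, hψ]
end L2Fourier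

/-! ### The phase on a fibre of fixed total frequency -/

section Fibre
variable {E : Type*} [NormedAddCommGroup E] [InnerProductSpace ℝ E]

theorem hasDerivAt_norm_add_smul_pow {k : ℕ} (hk : 2 ≤ k) (c θ : E) (hθ : ‖θ‖ = 1) (r : ℝ) :
    HasDerivAt (fun r : ℝ => ‖c + r • θ‖ ^ k)
      (k * (‖c + r • θ‖ ^ (k - 2) * (inner ℝ c θ + r))) r := by
  have hk1 : (1 : ℝ) < k := by exact_mod_cast hk
  have h1 := hasFDerivAt_norm_rpow (c + r • θ) hk1
  have h2 : HasDerivAt (fun r : ℝ => c + r • θ) θ r := by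
    simpa using ((hasDerivAt_id r).smul_const θ).const_add c
  have h3 := h1.comp_hasDerivAt r h2
  have e : ((k : ℝ) - 2) = ((k - 2 : ℕ) : ℝ) := by push_cast [Nat.cast_sub hk]; ring
  rw [e] at h3
  simp only [Function.comp_def, Real.rpow_natCast] at h3
  have e' : (k : ℝ) * (‖c + r • θ‖ ^ (k - 2) * (inner ℝ c θ + r)) =
      ((k * ‖c + r • θ‖ ^ (k - 2)) • innerSL ℝ (c + r • θ)) θ := by
    simp [hθ]
    ring
  rw [e']
  exact h3

/-- Along a ray from the midpoint, the sum of the two dispersion relations has derivative at least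
`k r (‖a‖^(k-2) + ‖b‖^(k-2))`, `a = c + r θ` and `b = c - r θ` being the two frequencies. -/
theorem exists_hasDerivAt_norm_pow_add {k : ℕ} (hk : 2 ≤ k) (c θ : E) (hθ : ‖θ‖ = 1) (r : ℝ)
    (hr : 0 < r) :
    ∃ D : ℝ, HasDerivAt (fun r : ℝ => ‖c + r • θ‖ ^ k + ‖c - r • θ‖ ^ k) D r ∧
      k * (r * (‖c + r • θ‖ ^ (k - 2) + ‖c - r • θ‖ ^ (k - 2))) ≤ D := by
  have h1 := hasDerivAt_norm_add_smul_pow hk c θ hθ r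
  have h2 := hasDerivAt_norm_add_smul_pow hk c (-θ) (by rwa [norm_neg]) r
  simp only [smul_neg, ← sub_eq_add_neg, inner_neg_right] at h2
  refine ⟨_, h1.add h2, ?_⟩
  rw [← mul_add]
  refine mul_le_mul_of_nonneg_left ?_ (Nat.cast_nonneg k)
  set s : ℝ := inner ℝ c θ
  have hsq : ‖c + r • θ‖ ^ 2 - ‖c - r • θ‖ ^ 2 = 4 * r * s := by
    rw [norm_add_sq_real, norm_sub_sq_real, real_inner_smul_right]; ring
  have hs : 0 ≤ s * (‖c + r • θ‖ ^ (k - 2) - ‖c - r • θ‖ ^ (k - 2)) := by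
    rcases le_total 0 s with h | h
    · refine mul_nonneg h (sub_nonneg.2 (pow_le_pow_left₀ (norm_nonneg _) ?_ _))
      refine (pow_le_pow_iff_left₀ (norm_nonneg _) (norm_nonneg _) two_ne_zero).1 ?_
      nlinarith [mul_nonneg hr.le h]
    · refine mul_nonneg_of_nonpos_of_nonpos h
        (sub_nonpos.2 (pow_le_pow_left₀ (norm_nonneg _) ?_ _))
      refine (pow_le_pow_iff_left₀ (norm_nonneg _) (norm_nonneg _) two_ne_zero).1 ?_
      nlinarith [mul_nonneg hr.le (neg_nonneg.2 h)]
  linarith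

/-- Change of variables `s = g r` with the Jacobian bounded from below. -/
theorem setLIntegral_comp_mul_le {g g' w : ℝ → ℝ} {S T : Set ℝ} (hT : MeasurableSet T)
    (hTS : T ⊆ S) (hg : ∀ r ∈ T, HasDerivAt g (g' r) r) (hinj : Set.InjOn g S) {B : ℝ}
    (hB : 0 ≤ B) (hw : ∀ r ∈ T, w r ≤ B * g' r) (K : ℝ → ℝ≥0∞) :
    ∫⁻ r in T, K (g r) * ENNReal.ofReal (w r) ≤ ENNReal.ofReal B * ∫⁻ s, K s := by
  calc ∫⁻ r in T, K (g r) * ENNReal.ofReal (w r)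
      ≤ ∫⁻ r in T, ENNReal.ofReal B * (ENNReal.ofReal |g' r| * K (g r)) := by
        refine setLIntegral_mono' hT fun r hr => ?_
        rw [mul_comm, ← mul_assoc, ← ENNReal.ofReal_mul hB]
        gcongr
        exact (hw r hr).trans (mul_le_mul_of_nonneg_left (le_abs_self _) hB)
    _ = ENNReal.ofReal B * ∫⁻ s in g '' T, K s := by
        rw [lintegral_const_mul' _ _ ENNReal.ofReal_ne_top,
          lintegral_image_eq_lintegral_abs_deriv_mul hT
            (fun r hr => (hg r hr).hasDerivWithinAt) (hinj.mono hTS)]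
    _ ≤ _ := by gcongr; exact Measure.restrict_le_self

/-- Along a ray from the midpoint the Jacobian `r ^ (k - 1)` is at most a constant times the derivative
of the phase, since `r ≤ 2 N₂` while the derivative is at least `r N₂ ^ (k - 2)` up to a constant.
In particular no separation of the two frequencies is needed. -/
theorem setLIntegral_ray_le {k : ℕ} (hk : 2 ≤ k) (c θ : E) (hθ : ‖θ‖ = 1) {N₁ N₂ γ : ℝ}
    (hN₂ : 0 < N₂) (hN : N₁ ≤ N₂) (hγ : 1 ≤ γ) {T : Set ℝ} (hT : MeasurableSet T)
    (hT0 : T ⊆ Set.Ioi 0) (hT₁ : ∀ r ∈ T, ‖c + r • θ‖ ≤ 2 * N₁)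
    (hT₂ : ∀ r ∈ T, N₂ / 2 ≤ ‖c - r • θ‖ ∧ ‖c - r • θ‖ ≤ 2 * N₂) (K : ℝ → ℝ≥0∞) :
    ∫⁻ r in T, K (γ * (‖c + r • θ‖ ^ k + ‖c - r • θ‖ ^ k)) * ENNReal.ofReal (r ^ (k - 1)) ≤
      ENNReal.ofReal (4 ^ k) * ∫⁻ s, K s := by
  have hγ0 : 0 < γ := by linarith
  have hex : ∀ r : ℝ, ∃ D : ℝ, 0 < r →
      HasDerivAt (fun r : ℝ => ‖c + r • θ‖ ^ k + ‖c - r • θ‖ ^ k) D r ∧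
      k * (r * (‖c + r • θ‖ ^ (k - 2) + ‖c - r • θ‖ ^ (k - 2))) ≤ D := fun r => by
    by_cases hr : 0 < r
    · obtain ⟨D, hD⟩ := exists_hasDerivAt_norm_pow_add hk c θ hθ r hr
      exact ⟨D, fun _ => hD⟩
    · exact ⟨0, fun h => absurd h hr⟩
  choose D hD using hex
  have hk0 : (1 : ℝ) ≤ k := by exact_mod_cast (by omega : 1 ≤ k)
  -- the frequencies `c ± r θ` differ by `2 r θ`, so they do not vanish simultaneously
  have hDpos : ∀ r, 0 < r → 0 < D r := fun r hr => by
    refine lt_of_lt_of_le ?_ (hD r hr).2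
    have hab : 0 < ‖c + r • θ‖ ∨ 0 < ‖c - r • θ‖ := by
      by_contra! h
      have h1 : c + r • θ = 0 := norm_le_zero_iff.1 h.1
      have h2 : c - r • θ = 0 := norm_le_zero_iff.1 h.2
      have h3 : (2 * r) • θ = 0 := by
        have : (2 * r) • θ = (c + r • θ) - (c - r • θ) := by module
        rw [this, h1, h2, sub_zero]
      rcases smul_eq_zero.1 h3 with h | h
      · linarith
      · rw [h, norm_zero] at hθ; exact zero_ne_one hθ
    have : 0 < ‖c + r • θ‖ ^ (k - 2) + ‖c - r • θ‖ ^ (k - 2) := by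
      rcases hab with h | h
      · exact add_pos_of_pos_of_nonneg (by positivity) (by positivity)
      · exact add_pos_of_nonneg_of_pos (by positivity) (by positivity)
    positivity
  have hmono : StrictMonoOn (fun r : ℝ => γ * (‖c + r • θ‖ ^ k + ‖c - r • θ‖ ^ k)) (Set.Ioi 0) := by
    refine strictMonoOn_of_deriv_pos (convex_Ioi 0) (by fun_prop) fun r hr => ?_
    rw [interior_Ioi] at hr
    rw [((hD r hr).1.const_mul γ).deriv]
    exact mul_pos hγ0 (hDpos r hr)
  refine setLIntegral_comp_mul_le (g := fun r => γ * (‖c + r • θ‖ ^ k + ‖c - r • θ‖ ^ k))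
    (g' := fun r => γ * D r) (w := fun r => r ^ (k - 1)) hT hT0
    (fun r hr => (hD r (hT0 hr)).1.const_mul γ) hmono.injOn (by positivity) (fun r hr => ?_) K
  have hr0 : 0 < r := hT0 hr
  have hr2 : r ≤ 4 * (N₂ / 2) := by
    have h1 : 2 * r = ‖(c + r • θ) - (c - r • θ)‖ := by
      rw [show (c + r • θ) - (c - r • θ) = (2 * r) • θ by module, norm_smul, hθ, mul_one,
        Real.norm_of_nonneg (by linarith)]
    have h2 := norm_sub_le (c + r • θ) (c - r • θ)
    linarith [hT₁ r hr, (hT₂ r hr).2]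
  calc r ^ (k - 1) = r * r ^ (k - 2) := by
        rw [← pow_succ']; congr 1; omega
    _ ≤ r * (4 * (N₂ / 2)) ^ (k - 2) := by gcongr
    _ ≤ r * (4 ^ (k - 2) * ‖c - r • θ‖ ^ (k - 2)) := by
        rw [mul_pow]; gcongr; exact (hT₂ r hr).1
    _ = 4 ^ (k - 2) * (r * ‖c - r • θ‖ ^ (k - 2)) := by ring
    _ ≤ 4 ^ k * D r := by
        have hle : r * ‖c - r • θ‖ ^ (k - 2) ≤ D r := by
          refine le_trans ?_ (hD r hr0).2
          have h0 : 0 ≤ r * ‖c + r • θ‖ ^ (k - 2) := by positivity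
          have h1 : 0 ≤ r * ‖c - r • θ‖ ^ (k - 2) := by positivity
          nlinarith
        refine mul_le_mul (pow_le_pow_right₀ (by norm_num) (by omega)) hle (by positivity)
          (by positivity)
    _ ≤ 4 ^ k * (γ * D r) := by
        have := hDpos r hr0
        gcongr
        nlinarith

variable [FiniteDimensional ℝ E] [MeasurableSpace E] [BorelSpace E]

/-- Integration in polar coordinates. -/
theorem lintegral_eq_lintegral_toSphere [Nontrivial E] {f : E → ℝ≥0∞} (hf : Measurable f) :
    ∫⁻ x, f x = ∫⁻ θ, ∫⁻ r in Set.Ioi (0 : ℝ),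
      f (r • (θ : E)) * ENNReal.ofReal (r ^ (Module.finrank ℝ E - 1))
        ∂(volume : Measure ℝ) ∂((volume : Measure E).toSphere) := by
  have hmp := Measure.measurePreserving_homeomorphUnitSphereProd (volume : Measure E)
  have h1 : ∫⁻ x, f x = ∫⁻ x : ({0}ᶜ : Set E), f x ∂((volume : Measure E).comap (↑)) := by
    rw [lintegral_subtype_comap (measurableSet_singleton (0 : E)).compl, restrict_compl_singleton]
  have hm : Measurable fun p : Metric.sphere (0 : E) 1 × Set.Ioi (0 : ℝ) =>
      f ((p.2 : ℝ) • (p.1 : E)) := hf.comp (by fun_prop)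
  have h2 : ∫⁻ x : ({0}ᶜ : Set E), f x ∂((volume : Measure E).comap (↑)) =
      ∫⁻ p, f ((p.2 : ℝ) • (p.1 : E)) ∂((volume : Measure E).toSphere.prod
        (Measure.volumeIoiPow (Module.finrank ℝ E - 1))) := by
    rw [← hmp.lintegral_comp hm]
    refine lintegral_congr fun x => ?_
    have := congrArg Subtype.val ((homeomorphUnitSphereProd E).symm_apply_apply x)
    rw [homeomorphUnitSphereProd_symm_apply_coe] at this
    rw [this]
  rw [h1, h2, lintegral_prod _ hm.aemeasurable]
  refine lintegral_congr fun θ => ?_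
  have hm' : Measurable fun r : ℝ => f (r • (θ : E)) := hf.comp (by fun_prop)
  have hm'' : Measurable fun r : Set.Ioi (0 : ℝ) => f ((r : ℝ) • (θ : E)) :=
    hm'.comp measurable_subtype_coe
  rw [Measure.volumeIoiPow, lintegral_withDensity_eq_lintegral_mul _ (by fun_prop) hm'']
  rw [← lintegral_subtype_comap measurableSet_Ioi]
  refine lintegral_congr fun r => ?_
  simp [mul_comm]

/-- The directions of the rays from the origin that pass close to `-c` fill a set of surface measure
`O((N / ‖c‖)^(d-1))`: the sector over it, of thickness `N`, lies in a ball of radius `5 N`. -/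
theorem toSphere_directions_mul_le [Nontrivial E] (c : E) {N : ℝ} (hN : 0 < N) :
    (volume : Measure E).toSphere {θ | ‖c + ‖c‖ • (θ : E)‖ ≤ 4 * N} *
        ENNReal.ofReal (‖c‖ ^ (Module.finrank ℝ E - 1)) ≤
      ENNReal.ofReal (5 ^ Module.finrank ℝ E * N ^ (Module.finrank ℝ E - 1)) *
        volume (Metric.ball (0 : E) 1) := by
  set n := Module.finrank ℝ E with hn
  have hn1 : 1 ≤ n := Module.finrank_pos
  set Ω : Set (Metric.sphere (0 : E) 1) := {θ | ‖c + ‖c‖ • (θ : E)‖ ≤ 4 * N} with hΩ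
  have hΩm : MeasurableSet Ω := by
    have h : Continuous fun θ : Metric.sphere (0 : E) 1 => ‖c + ‖c‖ • (θ : E)‖ := by fun_prop
    exact (isClosed_le h continuous_const).measurableSet
  have hN0 : ENNReal.ofReal N ≠ 0 := by simpa using hN
  have key : (volume : Measure E).toSphere Ω * ENNReal.ofReal (‖c‖ ^ (n - 1)) * ENNReal.ofReal N ≤
      ENNReal.ofReal (5 ^ n * N ^ (n - 1)) * volume (Metric.ball (0 : E) 1) * ENNReal.ofReal N := by
    calc (volume : Measure E).toSphere Ω * ENNReal.ofReal (‖c‖ ^ (n - 1)) * ENNReal.ofReal N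
        = ∫⁻ θ in Ω, ∫⁻ r in Set.Ioc ‖c‖ (‖c‖ + N), ENNReal.ofReal (‖c‖ ^ (n - 1))
            ∂(volume : Measure ℝ) ∂((volume : Measure E).toSphere) := by
          simp only [setLIntegral_const, Real.volume_Ioc, add_sub_cancel_left]
          ring
      _ ≤ ∫⁻ θ in Ω, ∫⁻ r in Set.Ioi (0 : ℝ),
            (Metric.closedBall (-c) (5 * N)).indicator 1 (r • (θ : E)) *
              ENNReal.ofReal (r ^ (n - 1))
            ∂(volume : Measure ℝ) ∂((volume : Measure E).toSphere) := by
          refine setLIntegral_mono' hΩm fun θ hθ => ?_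
          refine le_trans (setLIntegral_mono' measurableSet_Ioc fun r hr => ?_)
            (lintegral_mono_set (fun r hr => lt_of_le_of_lt (norm_nonneg c) hr.1))
          have hmem : r • (θ : E) ∈ Metric.closedBall (-c) (5 * N) := by
            rw [mem_closedBall_iff_norm, sub_neg_eq_add]
            have : r • (θ : E) + c = (c + ‖c‖ • (θ : E)) + (r - ‖c‖) • (θ : E) := by module
            rw [this]
            refine (norm_add_le _ _).trans ?_
            rw [norm_smul, norm_eq_of_mem_sphere, mul_one, Real.norm_of_nonneg (by linarith [hr.1])]
            have h4 : ‖c + ‖c‖ • (θ : E)‖ ≤ 4 * N := hθ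
            linarith [hr.2]
          rw [Set.indicator_of_mem hmem, Pi.one_apply, one_mul]
          have := hr.1.le
          gcongr
      _ ≤ ∫⁻ θ, ∫⁻ r in Set.Ioi (0 : ℝ),
            (Metric.closedBall (-c) (5 * N)).indicator 1 (r • (θ : E)) *
              ENNReal.ofReal (r ^ (n - 1))
            ∂(volume : Measure ℝ) ∂((volume : Measure E).toSphere) := setLIntegral_le_lintegral _ _
      _ = ∫⁻ x, (Metric.closedBall (-c) (5 * N)).indicator 1 x :=
          (lintegral_eq_lintegral_toSphere
            (measurable_one.indicator Metric.isClosed_closedBall.measurableSet)).symm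
      _ = volume (Metric.closedBall (-c) (5 * N)) :=
          lintegral_indicator_one Metric.isClosed_closedBall.measurableSet
      _ = _ := by
          rw [Measure.addHaar_closedBall _ _ (by positivity), mul_right_comm,
            ← ENNReal.ofReal_mul (by positivity)]
          congr 2
          rw [mul_pow, mul_assoc, ← pow_succ, Nat.sub_add_cancel hn1]
  exact (ENNReal.mul_le_mul_iff_left hN0 ENNReal.ofReal_ne_top).1 key

/-- The set of directions hit by the fibre has surface measure `O((N₁ / N₂)^(d-1))`. -/
theorem toSphere_directions_le [Nontrivial E] (c : E) {N₁ N₂ : ℝ} (hN₁ : 0 < N₁) (hN₂ : 0 < N₂)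
    (h : N₂ ≤ 16 * N₁ ∨ N₂ ≤ 8 * ‖c‖) :
    (volume : Measure E).toSphere {θ | ‖c + ‖c‖ • (θ : E)‖ ≤ 4 * N₁} ≤
      ENNReal.ofReal (Module.finrank ℝ E * 40 ^ Module.finrank ℝ E *
        (N₁ / N₂) ^ (Module.finrank ℝ E - 1)) * volume (Metric.ball (0 : E) 1) := by
  set n := Module.finrank ℝ E with hn
  have hn1 : 1 ≤ n := Module.finrank_pos
  have hn1' : (1 : ℝ) ≤ n := by exact_mod_cast hn1
  rcases h with h | h
  · refine (measure_mono (Set.subset_univ _)).trans ?_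
    rw [Measure.toSphere_apply_univ]
    gcongr
    rw [← ENNReal.ofReal_natCast, ← hn, mul_assoc]
    refine ENNReal.ofReal_le_ofReal (le_mul_of_one_le_right (by positivity) ?_)
    have h1 : 1 / 16 ≤ N₁ / N₂ := by
      rw [div_le_div_iff₀ (by norm_num) hN₂]; linarith
    calc (1 : ℝ) ≤ 40 ^ 1 * (40 ^ (n - 1) * (1 / 16) ^ (n - 1)) := by
          rw [← mul_pow]
          have : (1 : ℝ) ≤ (40 * (1 / 16)) ^ (n - 1) := one_le_pow₀ (by norm_num)
          linarith
      _ = 40 ^ n * (1 / 16) ^ (n - 1) := by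
          rw [← mul_assoc, ← pow_add, Nat.add_sub_cancel' hn1]
      _ ≤ _ := by gcongr
  · have hc : 0 < ‖c‖ := by linarith
    have hc0 : ENNReal.ofReal (‖c‖ ^ (n - 1)) ≠ 0 := by
      have : 0 < ‖c‖ ^ (n - 1) := by positivity
      exact (ENNReal.ofReal_pos.2 this).ne'
    refine (ENNReal.mul_le_mul_iff_left hc0 ENNReal.ofReal_ne_top).1 ?_
    refine (toSphere_directions_mul_le c hN₁).trans ?_
    rw [mul_right_comm, ← ENNReal.ofReal_mul (by positivity)]
    refine mul_le_mul_left (ENNReal.ofReal_le_ofReal ?_) _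
    rw [← hn]
    calc (5 : ℝ) ^ n * N₁ ^ (n - 1) = 5 ^ n * ((N₁ / N₂) ^ (n - 1) * N₂ ^ (n - 1)) := by
          rw [← mul_pow, div_mul_cancel₀ _ hN₂.ne']
      _ ≤ 5 ^ n * ((N₁ / N₂) ^ (n - 1) * (8 * ‖c‖) ^ (n - 1)) := by gcongr
      _ = (5 ^ n * 8 ^ (n - 1)) * ((N₁ / N₂) ^ (n - 1) * ‖c‖ ^ (n - 1)) := by
          rw [mul_pow]; ring
      _ ≤ (n * 40 ^ n) * ((N₁ / N₂) ^ (n - 1) * ‖c‖ ^ (n - 1)) := by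
          refine mul_le_mul_of_nonneg_right ?_ (by positivity)
          calc (5 : ℝ) ^ n * 8 ^ (n - 1) ≤ 5 ^ n * 8 ^ n := by
                gcongr
                · norm_num
                · omega
            _ = 1 * 40 ^ n := by rw [← mul_pow]; norm_num
            _ ≤ n * 40 ^ n := by gcongr
      _ = _ := by ring

/-- The density bound `C_k β (N₁ / N₂)^(k-1)` of the fibre estimate, where `β` stands for the volume of
the unit ball. -/
noncomputable def fibreConst (k : ℕ) (N₁ N₂ : ℝ) (β : ℝ≥0∞) : ℝ≥0∞ :=
  ENNReal.ofReal (4 ^ k) * (ENNReal.ofReal (k * 40 ^ k * (N₁ / N₂) ^ (k - 1)) * β)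

/-- For a fixed total frequency `2 c`, the push-forward of Lebesgue measure on the admissible
frequencies under the sum of the dispersion relations has density `O((N₁ / N₂)^(k-1))`. -/
theorem setLIntegral_fibre_le {k : ℕ} (hk : 2 ≤ k) (hE : Module.finrank ℝ E = k) (c : E)
    {N₁ N₂ γ : ℝ} (hN₁ : 0 < N₁) (hN : N₁ ≤ N₂) (hγ : 1 ≤ γ) {K : ℝ → ℝ≥0∞} (hK : Measurable K) :
    ∫⁻ ρ in {ρ : E | ‖c + ρ‖ ≤ 2 * N₁ ∧ N₂ / 2 ≤ ‖c - ρ‖ ∧ ‖c - ρ‖ ≤ 2 * N₂},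
      K (γ * (‖c + ρ‖ ^ k + ‖c - ρ‖ ^ k)) ≤
    fibreConst k N₁ N₂ (volume (Metric.ball (0 : E) 1)) * ∫⁻ s, K s := by
  have hN₂ : 0 < N₂ := hN₁.trans_le hN
  have : Nontrivial E := Module.nontrivial_of_finrank_pos (R := ℝ) (by omega)
  set S : Set E := {ρ : E | ‖c + ρ‖ ≤ 2 * N₁ ∧ N₂ / 2 ≤ ‖c - ρ‖ ∧ ‖c - ρ‖ ≤ 2 * N₂} with hS
  have hSm : MeasurableSet S := by
    have h₁ : Continuous fun ρ : E => ‖c + ρ‖ := by fun_prop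
    have h₂ : Continuous fun ρ : E => ‖c - ρ‖ := by fun_prop
    exact ((isClosed_le h₁ continuous_const).inter ((isClosed_le continuous_const h₂).inter
      (isClosed_le h₂ continuous_const))).measurableSet
  by_cases hcase : N₂ ≤ 16 * N₁ ∨ N₂ ≤ 8 * ‖c‖
  swap
  · -- the two frequencies differ too much for their sum to be as small as `2 c`
    push Not at hcase
    have : S = ∅ := by
      refine Set.eq_empty_of_forall_notMem fun ρ hρ => ?_
      have h1 : c - ρ = (2 : ℝ) • c - (c + ρ) := by module
      have h2 := norm_sub_le ((2 : ℝ) • c) (c + ρ)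
      rw [← h1, norm_smul, Real.norm_ofNat] at h2
      linarith [hρ.1, hρ.2.1]
    rw [this, Measure.restrict_empty, lintegral_zero_measure]
    exact zero_le
  set Ω : Set (Metric.sphere (0 : E) 1) := {θ | ‖c + ‖c‖ • (θ : E)‖ ≤ 4 * N₁} with hΩ
  have hΩm : MeasurableSet Ω := by
    have h : Continuous fun θ : Metric.sphere (0 : E) 1 => ‖c + ‖c‖ • (θ : E)‖ := by fun_prop
    exact (isClosed_le h continuous_const).measurableSet
  rw [← lintegral_indicator hSm, lintegral_eq_lintegral_toSphere
    ((show Measurable fun ρ : E => K (γ * (‖c + ρ‖ ^ k + ‖c - ρ‖ ^ k)) from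
      hK.comp (by fun_prop)).indicator hSm)]
  have hray : ∀ θ : Metric.sphere (0 : E) 1, ∫⁻ r in Set.Ioi (0 : ℝ),
      S.indicator (fun ρ => K (γ * (‖c + ρ‖ ^ k + ‖c - ρ‖ ^ k))) (r • (θ : E)) *
        ENNReal.ofReal (r ^ (Module.finrank ℝ E - 1)) ≤
      Ω.indicator (fun _ => ENNReal.ofReal (4 ^ k) * ∫⁻ s, K s) θ := fun θ => by
    have hθ : ‖(θ : E)‖ = 1 := norm_eq_of_mem_sphere θ
    set T : Set ℝ := Set.Ioi 0 ∩ (fun r : ℝ => r • (θ : E)) ⁻¹' S with hT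
    have hSθ : MeasurableSet ((fun r : ℝ => r • (θ : E)) ⁻¹' S) :=
      hSm.preimage (by fun_prop)
    have hTm : MeasurableSet T := measurableSet_Ioi.inter hSθ
    have heq : ∫⁻ r in Set.Ioi (0 : ℝ),
        S.indicator (fun ρ => K (γ * (‖c + ρ‖ ^ k + ‖c - ρ‖ ^ k))) (r • (θ : E)) *
          ENNReal.ofReal (r ^ (Module.finrank ℝ E - 1)) =
        ∫⁻ r in T, K (γ * (‖c + r • (θ : E)‖ ^ k + ‖c - r • (θ : E)‖ ^ k)) *
          ENNReal.ofReal (r ^ (k - 1)) := by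
      rw [hT, Set.inter_comm, ← Measure.restrict_restrict hSθ, ← lintegral_indicator hSθ]
      refine lintegral_congr fun r => ?_
      by_cases hr : r • (θ : E) ∈ S
      · rw [Set.indicator_of_mem hr, Set.indicator_of_mem
          (show r ∈ (fun r : ℝ => r • (θ : E)) ⁻¹' S from hr), hE]
      · rw [Set.indicator_of_notMem hr, Set.indicator_of_notMem
          (show r ∉ (fun r : ℝ => r • (θ : E)) ⁻¹' S from hr), zero_mul]
    rw [heq]
    by_cases hmem : θ ∈ Ω
    · rw [Set.indicator_of_mem hmem]
      exact setLIntegral_ray_le hk c θ hθ hN₂ hN hγ hTm Set.inter_subset_left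
        (fun r hr => hr.2.1) (fun r hr => hr.2.2) K
    · -- if `c + r θ` is small, then `r` is close to `‖c‖`, so `θ` is an admissible direction
      have : T = ∅ := by
        refine Set.eq_empty_of_forall_notMem fun r hr => hmem ?_
        have hr0 : 0 < r := hr.1
        have h1 : ‖c + r • (θ : E)‖ ≤ 2 * N₁ := hr.2.1
        have h2 : |r - ‖c‖| ≤ 2 * N₁ := by
          have h3 := abs_norm_sub_norm_le (r • (θ : E)) (-c)
          rw [sub_neg_eq_add, norm_neg, norm_smul, hθ, mul_one, Real.norm_of_nonneg hr0.le,
            add_comm] at h3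
          exact h3.trans h1
        have h4 : c + ‖c‖ • (θ : E) = (c + r • (θ : E)) - (r - ‖c‖) • (θ : E) := by module
        change ‖c + ‖c‖ • (θ : E)‖ ≤ 4 * N₁
        rw [h4]
        refine (norm_sub_le _ _).trans ?_
        rw [norm_smul, hθ, mul_one, Real.norm_eq_abs]
        linarith
      rw [this, Measure.restrict_empty, lintegral_zero_measure]
      exact zero_le
  refine (lintegral_mono hray).trans ?_
  rw [lintegral_indicator_const hΩm, fibreConst]
  have hdir := toSphere_directions_le c hN₁ hN₂ hcase
  rw [hE] at hdir
  calc _ ≤ ENNReal.ofReal (4 ^ k) * (∫⁻ s, K s) *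
        (ENNReal.ofReal (k * 40 ^ k * (N₁ / N₂) ^ (k - 1)) * volume (Metric.ball (0 : E) 1)) := by
        gcongr
    _ = _ := by ring
end Fibre

/-! ### The push-forward to space-time frequencies -/

section SumMap
variable {E : Type*} [NormedAddCommGroup E] [InnerProductSpace ℝ E] [FiniteDimensional ℝ E]
  [MeasurableSpace E] [BorelSpace E]

/-- The fibre estimate integrated over the total frequency: the shear `(η, ζ) ↦ (η, η + ζ)` preserves
Lebesgue measure, and the fibre over `ξ` is centred at the midpoint `ξ / 2`. -/
theorem setLIntegral_sum_le {k : ℕ} (hk : 2 ≤ k) (hE : Module.finrank ℝ E = k)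
    {N₁ N₂ γ : ℝ} (hN₁ : 0 < N₁) (hN : N₁ ≤ N₂) (hγ : 1 ≤ γ) {K : ℝ × E → ℝ≥0∞}
    (hK : Measurable K) :
    ∫⁻ p in {η : E | ‖η‖ ≤ 2 * N₁} ×ˢ {ζ : E | N₂ / 2 ≤ ‖ζ‖ ∧ ‖ζ‖ ≤ 2 * N₂},
      K (γ * (‖p.1‖ ^ k + ‖p.2‖ ^ k), p.1 + p.2) ∂(volume.prod volume) ≤
    fibreConst k N₁ N₂ (volume (Metric.ball (0 : E) 1)) * ∫⁻ q, K q := by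
  set S : Set (E × E) := {η : E | ‖η‖ ≤ 2 * N₁} ×ˢ {ζ : E | N₂ / 2 ≤ ‖ζ‖ ∧ ‖ζ‖ ≤ 2 * N₂} with hS
  have hSm : MeasurableSet S :=
    ((isClosed_le continuous_norm continuous_const).prod
      ((isClosed_le continuous_const continuous_norm).inter
        (isClosed_le continuous_norm continuous_const))).measurableSet
  set f : E × E → ℝ≥0∞ := S.indicator fun p => K (γ * (‖p.1‖ ^ k + ‖p.2‖ ^ k), p.1 + p.2) with hf
  have hfm : Measurable f := Measurable.indicator (hK.comp (by fun_prop)) hSm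
  have hSρ : ∀ ξ : E, MeasurableSet {ρ : E | ‖(2⁻¹ : ℝ) • ξ + ρ‖ ≤ 2 * N₁ ∧
      N₂ / 2 ≤ ‖(2⁻¹ : ℝ) • ξ - ρ‖ ∧ ‖(2⁻¹ : ℝ) • ξ - ρ‖ ≤ 2 * N₂} := fun ξ => by
    have h₁ : Continuous fun ρ : E => ‖(2⁻¹ : ℝ) • ξ + ρ‖ := by fun_prop
    have h₂ : Continuous fun ρ : E => ‖(2⁻¹ : ℝ) • ξ - ρ‖ := by fun_prop
    exact ((isClosed_le h₁ continuous_const).inter ((isClosed_le continuous_const h₂).inter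
      (isClosed_le h₂ continuous_const))).measurableSet
  calc ∫⁻ p in S, K (γ * (‖p.1‖ ^ k + ‖p.2‖ ^ k), p.1 + p.2) ∂(volume.prod volume)
      = ∫⁻ η : E, ∫⁻ ζ : E, f (η, ζ) := by
        rw [← lintegral_indicator hSm, lintegral_prod _ hfm.aemeasurable]
    _ = ∫⁻ η : E, ∫⁻ ξ : E, f (η, ξ - η) :=
        lintegral_congr fun η => (lintegral_sub_right_eq_self (fun ζ => f (η, ζ)) η).symm
    _ = ∫⁻ ξ : E, ∫⁻ η : E, f (η, ξ - η) :=
        lintegral_lintegral_swap (hfm.comp (by fun_prop : Measurable fun p : E × E =>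
          (p.1, p.2 - p.1))).aemeasurable
    _ = ∫⁻ ξ : E, ∫⁻ ρ : E, f ((2⁻¹ : ℝ) • ξ + ρ, (2⁻¹ : ℝ) • ξ - ρ) := by
        refine lintegral_congr fun ξ => ?_
        rw [← lintegral_add_left_eq_self (fun η => f (η, ξ - η)) ((2⁻¹ : ℝ) • ξ)]
        refine lintegral_congr fun ρ => ?_
        congr 2
        module
    _ ≤ ∫⁻ ξ : E, fibreConst k N₁ N₂ (volume (Metric.ball (0 : E) 1)) * ∫⁻ s, K (s, ξ) := by
        refine lintegral_mono fun ξ => ?_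
        refine le_trans (le_of_eq ?_) (setLIntegral_fibre_le hk hE ((2⁻¹ : ℝ) • ξ) hN₁ hN hγ
          (hK.comp (by fun_prop : Measurable fun s : ℝ => (s, ξ))))
        rw [← lintegral_indicator (hSρ ξ)]
        refine lintegral_congr fun ρ => ?_
        simp only [hf, hS, Set.indicator_apply, Set.mem_prod, Set.mem_ofPred_eq]
        congr 3
        module
    _ = _ := by
        rw [lintegral_const_mul _ hK.lintegral_prod_left', Measure.volume_eq_prod,
          lintegral_prod_symm _ hK.aemeasurable]

/-- The map taking a pair of frequencies to its space-time frequency: `γ` times the sum of the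
dispersion relations, and the total frequency. -/
noncomputable def sumMap (k : ℕ) (γ : ℝ) (p : E × E) : WithLp 2 (ℝ × E) :=
  WithLp.toLp 2 (γ * (‖p.1‖ ^ k + ‖p.2‖ ^ k), p.1 + p.2)

theorem measurable_sumMap (k : ℕ) (γ : ℝ) : Measurable (sumMap k γ : E × E → WithLp 2 (ℝ × E)) := by
  unfold sumMap
  fun_prop

/-- The push-forward of Lebesgue measure on the frequency supports is dominated by Lebesgue measure
on space-time frequencies. -/
theorem map_sumMap_le {k : ℕ} (hk : 2 ≤ k) (hE : Module.finrank ℝ E = k)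
    {N₁ N₂ γ : ℝ} (hN₁ : 0 < N₁) (hN : N₁ ≤ N₂) (hγ : 1 ≤ γ) :
    (((volume : Measure E).restrict {η : E | ‖η‖ ≤ 2 * N₁}).prod
      ((volume : Measure E).restrict {ζ : E | N₂ / 2 ≤ ‖ζ‖ ∧ ‖ζ‖ ≤ 2 * N₂})).map (sumMap k γ) ≤
    fibreConst k N₁ N₂ (volume (Metric.ball (0 : E) 1)) • volume := by
  refine Measure.le_iff.2 fun s hs => ?_
  have hs' : MeasurableSet ((WithLp.toLp 2 : ℝ × E → WithLp 2 (ℝ × E)) ⁻¹' s) :=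
    WithLp.measurable_toLp 2 _ hs
  have h := setLIntegral_sum_le hk hE hN₁ hN hγ
    (measurable_one.indicator hs' : Measurable (Set.indicator _ (1 : ℝ × E → ℝ≥0∞)))
  rw [lintegral_indicator_one hs', (WithLp.volume_preserving_toLp ℝ E).measure_preimage
    hs.nullMeasurableSet] at h
  rw [Measure.map_apply (measurable_sumMap k γ) hs, Measure.smul_apply, smul_eq_mul,
    Measure.prod_restrict, ← lintegral_indicator_one (measurable_sumMap k γ hs)]
  exact h
end SumMap

/-! ### Littlewood-Paley pieces and the product of two waves -/

theorem IsDyadic.pos {M : ℝ} (h : IsDyadic M) : 0 < M := by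
  obtain ⟨j, rfl⟩ := h
  positivity

theorem eLpNorm_two_sq {α : Type*} [MeasurableSpace α] (μ : Measure α) (f : α → ℂ) :
    eLpNorm f 2 μ ^ 2 = ∫⁻ x, ‖f x‖ₑ ^ 2 ∂μ := by
  have h := eLpNorm_nnreal_pow_eq_lintegral (f := f) (μ := μ) (p := 2) two_ne_zero
  simpa using h

section LittlewoodPaley
variable {k : ℕ} (φ : LPCutoff k)

/-- The Fourier transform of `P_M u`, in Mathlib's normalization. -/
noncomputable def lpPiece (M : ℝ) (u : LTwo k) (ξ : Euc k) : ℂ :=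
  lpSymbol φ M ((2 * Real.pi) • ξ) * (𝓕 u : LTwo k) ξ

theorem memLp_lpPiece (M : ℝ) (u : LTwo k) : MemLp (lpPiece φ M u) 2 volume :=
  memLp_symbol_mul (lpSymbol φ M) (𝓕 u)

variable {φ}

theorem lpPiece_eq_zero_of_lt {M : ℝ} (hM : 0 < M) (u : LTwo k) {ξ : Euc k}
    (hξ : 2 * (M / (2 * Real.pi)) < ‖ξ‖) : lpPiece φ M u ξ = 0 := by
  have hπ := Real.pi_pos
  have h2 : 2 * M < 2 * Real.pi * ‖ξ‖ := by
    rw [mul_div_assoc', div_lt_iff₀ (by positivity)] at hξ; linarith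
  have hs : lpSymbol φ M ((2 * Real.pi) • ξ) = 0 := by
    change ((φ.toFun (M⁻¹ • (2 * Real.pi) • ξ) -
      φ.toFun ((2 * M⁻¹) • (2 * Real.pi) • ξ) : ℝ) : ℂ) = 0
    have e : M⁻¹ * (2 * M) = 2 := by field_simp
    have h3 : 2 ≤ M⁻¹ * (2 * Real.pi * ‖ξ‖) := by
      exact e.symm.trans_le (mul_le_mul_of_nonneg_left h2.le (by positivity))
    rw [φ.eq_zero, φ.eq_zero, sub_zero, Complex.ofReal_zero]
    · rw [norm_smul, norm_smul, Real.norm_of_nonneg (by positivity),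
        Real.norm_of_nonneg (by positivity)]
      linarith
    · rwa [norm_smul, norm_smul, Real.norm_of_nonneg (by positivity),
        Real.norm_of_nonneg (by positivity)]
  rw [lpPiece, hs, zero_mul]

theorem lpPiece_eq_zero_of_gt {M : ℝ} (hM : 0 < M) (u : LTwo k) {ξ : Euc k}
    (hξ : ‖ξ‖ < M / (2 * Real.pi) / 2) : lpPiece φ M u ξ = 0 := by
  have hπ := Real.pi_pos
  have h2 : 2 * Real.pi * ‖ξ‖ < M / 2 := by
    rw [div_div, lt_div_iff₀ (by positivity)] at hξ; linarith
  have hs : lpSymbol φ M ((2 * Real.pi) • ξ) = 0 := by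
    change ((φ.toFun (M⁻¹ • (2 * Real.pi) • ξ) -
      φ.toFun ((2 * M⁻¹) • (2 * Real.pi) • ξ) : ℝ) : ℂ) = 0
    have e : M⁻¹ * (M / 2) = 1 / 2 := by field_simp
    have h3 : M⁻¹ * (2 * Real.pi * ‖ξ‖) ≤ 1 / 2 := by
      rw [← e]; gcongr
    rw [φ.eq_one, φ.eq_one, sub_self, Complex.ofReal_zero]
    · rw [norm_smul, norm_smul, Real.norm_of_nonneg (by positivity),
        Real.norm_of_nonneg (by positivity)]
      linarith
    · rw [norm_smul, norm_smul, Real.norm_of_nonneg (by positivity),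
        Real.norm_of_nonneg (by positivity)]
      linarith
  rw [lpPiece, hs, zero_mul]

theorem integrable_lpPiece {M : ℝ} (hM : 0 < M) (u : LTwo k) :
    Integrable (lpPiece φ M u) := by
  have hsupp : Function.support (lpPiece φ M u) ⊆
      Metric.closedBall 0 (2 * (M / (2 * Real.pi))) := fun ξ hξ => by
    rw [mem_closedBall_zero_iff]
    by_contra! h
    exact hξ (lpPiece_eq_zero_of_lt hM u h)
  rw [← integrableOn_iff_integrable_of_support_subset hsupp]
  have : IsFiniteMeasure ((volume : Measure (Euc k)).restrict
      (Metric.closedBall 0 (2 * (M / (2 * Real.pi))))) :=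
    ⟨by rw [Measure.restrict_apply_univ]; exact measure_closedBall_lt_top⟩
  exact ((memLp_lpPiece φ M u).restrict _).integrable one_le_two

/-- A bound for all the symbols of the operators `P_M`. -/
theorem exists_norm_lpSymbol_le (φ : LPCutoff k) :
    ∃ B : ℝ, 0 < B ∧ ∀ (M : ℝ) (ξ : Euc k), ‖lpSymbol φ M ξ‖ ≤ B := by
  obtain ⟨B, hB⟩ := φ.exists_bound
  refine ⟨B + B + 1, ?_, fun M ξ => ?_⟩
  · linarith [(norm_nonneg _).trans (hB 0)]
  · change ‖((φ.toFun (M⁻¹ • ξ) - φ.toFun ((2 * M⁻¹) • ξ) : ℝ) : ℂ)‖ ≤ _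
    rw [Complex.norm_real]
    linarith [norm_sub_le (φ.toFun (M⁻¹ • ξ)) (φ.toFun ((2 * M⁻¹) • ξ)), hB (M⁻¹ • ξ),
      hB ((2 * M⁻¹) • ξ)]

theorem lintegral_lpPiece_sq_le {B : ℝ} (hB : 0 ≤ B)
    (hBφ : ∀ (M : ℝ) (ξ : Euc k), ‖lpSymbol φ M ξ‖ ≤ B) (M : ℝ) (u : LTwo k) :
    ∫⁻ ξ, ‖lpPiece φ M u ξ‖ₑ ^ 2 ≤ ENNReal.ofReal (B * ‖u‖) ^ 2 := by
  rw [← eLpNorm_two_sq]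
  refine pow_le_pow_left' ?_ 2
  refine (eLpNorm_le_mul_eLpNorm_of_ae_le_mul (g := (𝓕 u : LTwo k)) (c := B)
    (Filter.Eventually.of_forall fun ξ => ?_) 2).trans (le_of_eq ?_)
  · rw [lpPiece, norm_mul]
    exact mul_le_mul_of_nonneg_right (hBφ _ _) (norm_nonneg _)
  · rw [ENNReal.ofReal_mul hB, ← Lp.enorm_def, ← ofReal_norm, Lp.norm_fourier_eq]

/-- The Fourier transform of `e^{itΛ^k} P_M u`, in Mathlib's normalization. -/
noncomputable def evolvedPiece (φ : LPCutoff k) (M : ℝ) (u : LTwo k) (t : ℝ) (ξ : Euc k) : ℂ :=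
  propagatorSymbol k t ((2 * Real.pi) • ξ) * lpPiece φ M u ξ

theorem propagator_lpProj_ae_eq {M : ℝ} (hM : 0 < M) (u : LTwo k) (t : ℝ) :
    (propagator k t (lpProj φ M u) : Euc k → ℂ) =ᵐ[volume]
      oscIntegral volume id (evolvedPiece φ M u t) := by
  set f := (memLp_lpPiece φ M u).toLp (lpPiece φ M u) with hf
  have hP : (𝓕 (lpProj φ M u) : LTwo k) = f := by
    change 𝓕 (𝓕⁻ f) = f
    exact FourierTransform.fourier_fourierInv_eq f
  have hae : evolvedPiece φ M u t =ᵐ[volume]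
      fun ξ => propagatorSymbol k t ((2 * Real.pi) • ξ) * (𝓕 (lpProj φ M u) : LTwo k) ξ := by
    rw [hP]
    filter_upwards [(memLp_lpPiece φ M u).coeFn_toLp] with ξ hξ
    rw [evolvedPiece, hf, hξ]
  have hm2 : MemLp (evolvedPiece φ M u t) 2 volume :=
    (memLp_congr_ae hae).2 (memLp_symbol_mul _ _)
  have hint : Integrable (evolvedPiece φ M u t) := by
    refine (integrable_lpPiece hM u).bdd_mul (c := ‖propagatorSymbol k t‖) ?_ ?_
    · exact Continuous.aestronglyMeasurable (by fun_prop)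
    · exact Filter.Eventually.of_forall fun ξ => (propagatorSymbol k t).norm_coe_le_norm _
  have h := fourierInv_toLp_ae_eq hint hm2
  have e : propagator k t (lpProj φ M u) = 𝓕⁻ (hm2.toLp (evolvedPiece φ M u t)) := by
    rw [propagator, fourierMult]
    congr 1
    exact (MemLp.toLp_eq_toLp_iff _ _).2 hae.symm
  rw [e]
  exact h

/-- The product of the two waves, as an oscillatory integral over pairs of frequencies. The factor
`(2π)^(k-1)` comes from the normalization: `t |2πξ|^k = 2π t (2π)^(k-1) |ξ|^k`. -/
noncomputable def waveProduct (φ : LPCutoff k) (M₁ M₂ : ℝ) (u v : LTwo k) (q : ℝ × Euc k) : ℂ :=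
  oscIntegral
    (((volume : Measure (Euc k)).restrict {η | ‖η‖ ≤ 2 * (M₁ / (2 * Real.pi))}).prod
      ((volume : Measure (Euc k)).restrict
        {ζ | M₂ / (2 * Real.pi) / 2 ≤ ‖ζ‖ ∧ ‖ζ‖ ≤ 2 * (M₂ / (2 * Real.pi))}))
    (sumMap k ((2 * Real.pi) ^ (k - 1)))
    (fun p => lpPiece φ M₁ u p.1 * lpPiece φ M₂ v p.2) (WithLp.toLp 2 q)

theorem waveProduct_eq_mul (hk : 1 ≤ k) {M₁ M₂ : ℝ} (hM₁ : 0 < M₁) (hM₂ : 0 < M₂) (u v : LTwo k)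
    (t : ℝ) (x : Euc k) :
    waveProduct φ M₁ M₂ u v (t, x) = oscIntegral volume id (evolvedPiece φ M₁ u t) x *
      oscIntegral volume id (evolvedPiece φ M₂ v t) x := by
  have hphase : ∀ (M : ℝ) (w : LTwo k) (ξ : Euc k),
      Complex.exp (((2 * Real.pi * inner ℝ (id ξ) x : ℝ) : ℂ) * Complex.I) * evolvedPiece φ M w t ξ =
      Complex.exp (((2 * Real.pi * inner ℝ ξ x + t * (2 * Real.pi * ‖ξ‖) ^ k : ℝ) : ℂ) * Complex.I) *
        lpPiece φ M w ξ := fun M w ξ => by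
    have hs : propagatorSymbol k t ((2 * Real.pi) • ξ) =
        Complex.exp (((t * (2 * Real.pi * ‖ξ‖) ^ k : ℝ) : ℂ) * Complex.I) := by
      change Complex.exp (((t * ‖(2 * Real.pi) • ξ‖ ^ k : ℝ) : ℂ) * Complex.I) = _
      rw [norm_smul, Real.norm_of_nonneg (by positivity)]
    rw [evolvedPiece, hs, ← mul_assoc, ← Complex.exp_add, id, Complex.ofReal_add, add_mul]
  have h₁ : oscIntegral volume id (evolvedPiece φ M₁ u t) x =
      ∫ η in {η : Euc k | ‖η‖ ≤ 2 * (M₁ / (2 * Real.pi))},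
        Complex.exp (((2 * Real.pi * inner ℝ η x + t * (2 * Real.pi * ‖η‖) ^ k : ℝ) : ℂ) *
          Complex.I) * lpPiece φ M₁ u η := by
    rw [oscIntegral, setIntegral_eq_integral_of_forall_compl_eq_zero]
    · exact integral_congr_ae (Filter.Eventually.of_forall fun η => hphase M₁ u η)
    · intro η hη
      rw [lpPiece_eq_zero_of_lt hM₁ u (not_le.1 hη), mul_zero]
  have h₂ : oscIntegral volume id (evolvedPiece φ M₂ v t) x =
      ∫ ζ in {ζ : Euc k | M₂ / (2 * Real.pi) / 2 ≤ ‖ζ‖ ∧ ‖ζ‖ ≤ 2 * (M₂ / (2 * Real.pi))},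
        Complex.exp (((2 * Real.pi * inner ℝ ζ x + t * (2 * Real.pi * ‖ζ‖) ^ k : ℝ) : ℂ) *
          Complex.I) * lpPiece φ M₂ v ζ := by
    rw [oscIntegral, setIntegral_eq_integral_of_forall_compl_eq_zero]
    · exact integral_congr_ae (Filter.Eventually.of_forall fun ζ => hphase M₂ v ζ)
    · intro ζ hζ
      rcases not_and_or.1 hζ with h | h
      · rw [lpPiece_eq_zero_of_gt hM₂ v (not_le.1 h), mul_zero]
      · rw [lpPiece_eq_zero_of_lt hM₂ v (not_le.1 h), mul_zero]
  rw [h₁, h₂, ← integral_prod_mul, waveProduct, oscIntegral]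
  refine integral_congr_ae (Filter.Eventually.of_forall fun p => ?_)
  dsimp only
  rw [mul_mul_mul_comm, ← Complex.exp_add, ← add_mul, ← Complex.ofReal_add]
  congr 4
  have hpow : (2 * Real.pi) ^ k = 2 * Real.pi * (2 * Real.pi) ^ (k - 1) := by
    rw [← pow_succ']; congr 1; omega
  simp only [sumMap, WithLp.prod_inner_apply, inner_add_left, mul_pow _ _ k]
  simp only [RCLike.inner_apply, conj_trivial]
  rw [← mul_pow, hpow]
  ring

theorem continuous_waveProduct {M₁ M₂ : ℝ} (hM₁ : 0 < M₁) (hM₂ : 0 < M₂) (u v : LTwo k) :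
    Continuous (waveProduct φ M₁ M₂ u v) :=
  (continuous_oscIntegral (measurable_sumMap k _)
    ((integrable_lpPiece hM₁ u).restrict.mul_prod (integrable_lpPiece hM₂ v).restrict)).comp
    (WithLp.prod_continuous_toLp 2 ℝ (Euc k))

theorem lintegral_waveProduct_sq_le (hk : 2 ≤ k) {M₁ M₂ : ℝ} (hM₁ : 0 < M₁) (hM : M₁ ≤ M₂)
    (u v : LTwo k) :
    ∫⁻ q, ‖waveProduct φ M₁ M₂ u v q‖ₑ ^ 2 ≤
      fibreConst k M₁ M₂ (volume (Metric.ball (0 : Euc k) 1)) *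
        ((∫⁻ η, ‖lpPiece φ M₁ u η‖ₑ ^ 2) * ∫⁻ ζ, ‖lpPiece φ M₂ v ζ‖ₑ ^ 2) := by
  have hM₂ : 0 < M₂ := hM₁.trans_le hM
  have hπ : 0 < 2 * Real.pi := by positivity
  have hπ1 : 1 ≤ 2 * Real.pi := by linarith [Real.pi_gt_three]
  have hmap := map_sumMap_le (E := Euc k) hk finrank_euclideanSpace_fin (div_pos hM₁ hπ)
    (div_le_div_of_nonneg_right hM hπ.le) (one_le_pow₀ hπ1 : 1 ≤ (2 * Real.pi) ^ (k - 1))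
  have hint := (integrable_lpPiece (φ := φ) hM₁ u).restrict
    (s := {η | ‖η‖ ≤ 2 * (M₁ / (2 * Real.pi))}) |>.mul_prod
    ((integrable_lpPiece (φ := φ) hM₂ v).restrict
      (s := {ζ | M₂ / (2 * Real.pi) / 2 ≤ ‖ζ‖ ∧ ‖ζ‖ ≤ 2 * (M₂ / (2 * Real.pi))}))
  have h := lintegral_oscIntegral_sq_le (measurable_sumMap k _) hint hmap
  have hc : fibreConst k (M₁ / (2 * Real.pi)) (M₂ / (2 * Real.pi))
      (volume (Metric.ball (0 : Euc k) 1)) =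
        fibreConst k M₁ M₂ (volume (Metric.ball (0 : Euc k) 1)) := by
    rw [fibreConst, fibreConst, div_div_div_cancel_right₀ hπ.ne']
  have hm : Measurable fun w : WithLp 2 (ℝ × Euc k) => ‖oscIntegral _ _ _ w‖ₑ ^ 2 :=
    (continuous_oscIntegral (measurable_sumMap k ((2 * Real.pi) ^ (k - 1)))
      hint).measurable.enorm.pow_const 2
  rw [hc, ← (WithLp.volume_preserving_toLp ℝ (Euc k)).lintegral_comp hm] at h
  refine h.trans (mul_le_mul_right ?_ _)
  simp only [enorm_mul, mul_pow]
  rw [lintegral_prod_mul ((integrable_lpPiece hM₁ u).restrict.1.enorm.pow_const 2)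
    ((integrable_lpPiece hM₂ v).restrict.1.enorm.pow_const 2)]
  gcongr <;> exact Measure.restrict_le_self

end LittlewoodPaley

/-- The constant of the fibre estimate is the square of a multiple of the gain. -/
theorem fibreConst_eq_sq {k : ℕ} (hk : 1 ≤ k) {M₁ M₂ β : ℝ} (hM₁ : 0 < M₁) (hM₂ : 0 < M₂)
    (hβ : 0 ≤ β) :
    fibreConst k M₁ M₂ (ENNReal.ofReal β) =
      ENNReal.ofReal (√(4 ^ k * (k * 40 ^ k) * β) * (M₁ / M₂) ^ (((k : ℝ) - 1) / 2)) ^ 2 := by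
  have hq : 0 < M₁ / M₂ := div_pos hM₁ hM₂
  have e : ((M₁ / M₂) ^ (((k : ℝ) - 1) / 2)) ^ 2 = (M₁ / M₂) ^ (k - 1) := by
    rw [← Real.rpow_natCast, ← Real.rpow_natCast, ← Real.rpow_mul hq.le]
    congr 1
    push_cast [Nat.cast_sub hk]
    ring
  rw [fibreConst, ← ENNReal.ofReal_mul (by positivity), ← ENNReal.ofReal_mul (by positivity),
    ← ENNReal.ofReal_pow (by positivity), mul_pow, Real.sq_sqrt (by positivity), e]
  congr 1
  ring

theorem proposition2p4 (k : ℕ) (hk : 2 ≤ k) (φ : LPCutoff k) :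
    ∃ C : ℝ, 0 < C ∧
      ∀ M₁ M₂ : ℝ, IsDyadic M₁ → IsDyadic M₂ → M₁ ≤ M₂ →
      ∀ u₀ v₀ : LTwo k,
        ∃ W : ℝ × Euc k → ℂ,
          MemLp W 2 (volume : Measure (ℝ × Euc k)) ∧
          IsSpaceTimeProduct W
            (fun t => propagator k t (lpProj φ M₁ u₀))
            (fun t => propagator k t (lpProj φ M₂ v₀)) ∧
          eLpNorm W 2 (volume : Measure (ℝ × Euc k)) ≤
            ENNReal.ofReal (C * (M₁ / M₂) ^ (((k : ℝ) - 1) / 2) * ‖u₀‖ * ‖v₀‖) := by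
  obtain ⟨B, hB, hBφ⟩ := exists_norm_lpSymbol_le φ
  set β : ℝ := (volume (Metric.ball (0 : Euc k) 1)).toReal with hβ
  have hβ_eq : volume (Metric.ball (0 : Euc k) 1) = ENNReal.ofReal β :=
    (ENNReal.ofReal_toReal measure_ball_lt_top.ne).symm
  have hβ0 : 0 < β := ENNReal.toReal_pos (Metric.measure_ball_pos _ _ one_pos).ne'
    measure_ball_lt_top.ne
  have hk0 : (0 : ℝ) < k := by exact_mod_cast (by omega : 0 < k)
  refine ⟨√(4 ^ k * (k * 40 ^ k) * β) * B ^ 2, by positivity,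
    fun M₁ M₂ hd₁ hd₂ hM u v => ?_⟩
  have hM₁ := hd₁.pos
  have hM₂ := hd₂.pos
  have hle : eLpNorm (waveProduct φ M₁ M₂ u v) 2 (volume : Measure (ℝ × Euc k)) ≤
      ENNReal.ofReal (√(4 ^ k * (k * 40 ^ k) * β) * B ^ 2 *
        (M₁ / M₂) ^ (((k : ℝ) - 1) / 2) * ‖u‖ * ‖v‖) := by
    rw [← ENNReal.pow_le_pow_left_iff two_ne_zero, eLpNorm_two_sq]
    refine (lintegral_waveProduct_sq_le hk hM₁ hM u v).trans ?_
    have hq : 0 ≤ (M₁ / M₂) ^ (((k : ℝ) - 1) / 2) := by positivity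
    calc _ ≤ ENNReal.ofReal (√(4 ^ k * (k * 40 ^ k) * β) * (M₁ / M₂) ^ (((k : ℝ) - 1) / 2)) ^ 2 *
          (ENNReal.ofReal (B * ‖u‖) ^ 2 * ENNReal.ofReal (B * ‖v‖) ^ 2) := by
          rw [hβ_eq, fibreConst_eq_sq (by omega) hM₁ hM₂ hβ0.le]
          gcongr
          · exact lintegral_lpPiece_sq_le hB.le hBφ M₁ u
          · exact lintegral_lpPiece_sq_le hB.le hBφ M₂ v
      _ = _ := by
          rw [← mul_pow, ← mul_pow, ← ENNReal.ofReal_mul (by positivity),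
            ← ENNReal.ofReal_mul (by positivity)]
          congr 2
          ring
  refine ⟨waveProduct φ M₁ M₂ u v, ⟨(continuous_waveProduct hM₁ hM₂ u v).aestronglyMeasurable,
    hle.trans_lt ENNReal.ofReal_lt_top⟩, fun t => ?_, hle⟩
  filter_upwards [propagator_lpProj_ae_eq hM₁ u t, propagator_lpProj_ae_eq hM₂ v t] with x h₁ h₂
  rw [waveProduct_eq_mul (by omega) hM₁ hM₂, h₁, h₂]
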